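/- Let $\Gamma=(\mathsf V,\mathsf E)$ be a finite simplicial graph with non-empty vertex set, and let $G_\Gamma=\langle v\in\mathsf V \mid vw=wv \text{ for } \{v,w\}\in\mathsf E\rangle$ be the associated right-angled Artin group. Its character torus $\mathbb T_{G_\Gamma}=\operatorname{Hom}(G_\Gamma,\mathbb C^*)$ is identified with $(\mathbb C^*)^{\mathsf V}$ by $\rho\mapsto(\rho(v))_{v\in\mathsf V}$. Let $$\mathcal V_1(G_\Gamma)=\{\rho\in\operatorname{Hom}(G_\Gamma,\mathbb C^*) \mid \dim_{\mathbb C}H^1(G_\Gamma,{}_\rho\mathbb C)\ge 1\}$$ be the first characteristic variety, where ${}_\rho\mathbb C$ is $\mathbb C$ with $g\in G_\Gamma$ acting as multiplication by $\rho(g)$. For $\mathsf W\subset\mathsf V$ let $\Gamma(\mathsf W)$ be the full subgraph of $\Gamma$ on $\mathsf W$, and let $$\mathbb T_{\mathsf W}=\{(t_v)_{v\in\mathsf V}\in(\mathbb C^*)^{\mathsf V}\mid t_v=1 \text{ for all } v\notin\mathsf W\}.$$ Call $\Gamma(\mathsf W)$ maximally disconnected if it is disconnected and $\mathsf W$ is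 maximal, with respect to inclusion, among the subsets of $\mathsf V$ with this property. (The empty graph counts as disconnected; this matters only if $\Gamma$ is complete, in which case $\mathsf W=\emptyset$, with $\mathbb T_\emptyset=\{1\}$, is the only such subset.) Then $$\mathcal V_1(G_\Gamma)=\bigcup_{\mathsf W}\mathbb T_{\mathsf W},$$ where the union is over all $\mathsf W\subset\mathsf V$ such that $\Gamma(\mathsf W)$ is maximally disconnected. Moreover, this is the decomposition of $\mathcal V_1(G_\Gamma)$ into irreducible components in the Zariski topology: the assignment $\mathsf W\mapsto\mathbb T_{\mathsf W}$ is a bijection from the set of these $\mathsf W$ onto the set of irreducible components of $\mathcal V_1(G_\Gamma)$. -/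

import Mathlib

noncomputable section

/-- The right-angled Artin group of the graph `Γ`: one generator for each vertex, and one relation
`v w = w v` for each edge `{v, w}`. -/
abbrev RAAG {V : Type} (Γ : SimpleGraph V) : Type :=
  PresentedGroup {r : FreeGroup V | ∃ v w, Γ.Adj v w ∧
    r = FreeGroup.of v * FreeGroup.of w * (FreeGroup.of w * FreeGroup.of v)⁻¹}

/-- The generator of the right-angled Artin group given by the vertex `v`. -/
def RAAG.gen {V : Type} (Γ : SimpleGraph V) (v : V) : RAAG Γ := PresentedGroup.of v

/-- The character torus `Hom(G, ℂ*)`. -/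
abbrev CharacterTorus (G : Type) [Group G] : Type := G →* ℂˣ

/-- The value at the character `ρ` of a regular function on the character torus. The coordinate
ring is the group algebra of the abelianization of `G`; a class `g` is the function `ρ ↦ ρ g`. -/
def CharacterTorus.eval {G : Type} [Group G] (ρ : CharacterTorus G) :
    MonoidAlgebra ℂ (Abelianization G) →ₐ[ℂ] ℂ :=
  MonoidAlgebra.lift ℂ ℂ (Abelianization G) ((Units.coeHom ℂ).comp (Abelianization.lift ρ))

/-- The set of common zeros in the character torus of a set of regular functions. -/
def CharacterTorus.zeros {G : Type} [Group G] (I : Set (MonoidAlgebra ℂ (Abelianization G))) :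
    Set (CharacterTorus G) :=
  {ρ | ∀ f ∈ I, CharacterTorus.eval ρ f = 0}

/-- The Zariski topology on the character torus: the closed sets are the sets of common zeros of
regular functions. -/
instance CharacterTorus.zariski (G : Type) [Group G] : TopologicalSpace (CharacterTorus G) :=
  TopologicalSpace.ofClosed {S | ∃ I, S = CharacterTorus.zeros I}
    ⟨{1}, by
      ext ρ
      simp [CharacterTorus.zeros]⟩
    (by
      intro A hA
      refine ⟨{f | ∃ I, CharacterTorus.zeros I ∈ A ∧ f ∈ I}, ?_⟩
      ext ρ
      constructor
      · rintro h f ⟨I, hI, hf⟩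
        exact h _ hI f hf
      · intro h S hS
        obtain ⟨I, rfl⟩ := hA hS
        exact fun f hf => h f ⟨I, hS, hf⟩)
    (by
      rintro _ ⟨I, rfl⟩ _ ⟨J, rfl⟩
      refine ⟨{f | ∃ a ∈ I, ∃ b ∈ J, f = a * b}, ?_⟩
      ext ρ
      constructor
      · rintro (h | h) _ ⟨a, ha, b, hb, rfl⟩
        · rw [map_mul, h a ha, zero_mul]
        · rw [map_mul, h b hb, mul_zero]
      · intro h
        by_contra hn
        simp only [Set.mem_union, not_or, CharacterTorus.zeros, Set.mem_ofPred_eq, not_forall] at hn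
        obtain ⟨⟨a, ha, ha0⟩, ⟨b, hb, hb0⟩⟩ := hn
        have := h _ ⟨a, ha, b, hb, rfl⟩
        rw [map_mul] at this
        exact (mul_ne_zero ha0 hb0) this)

/-- The one-dimensional complex representation on which `g` acts as multiplication by `ρ g`. -/
def CharacterTorus.rep {G : Type} [Group G] (ρ : CharacterTorus G) : Rep ℂ G :=
  Rep.of (((Algebra.lmul ℂ ℂ).toRingHom.toMonoidHom.comp ((Units.coeHom ℂ).comp ρ) :
    Representation ℂ G ℂ))

/-- The characteristic variety `𝒱_k(G)`: the characters `ρ` for which the first cohomology of `G`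
with coefficients twisted by `ρ` has dimension at least `k`. -/
def characteristicVariety (G : Type) [Group G] (k : ℕ) : Set (CharacterTorus G) :=
  {ρ | (k : Cardinal) ≤ Module.rank ℂ (groupCohomology ρ.rep 1)}

/-- The coordinate subtorus `𝕋_W` of the character torus of a right-angled Artin group: the
characters whose coordinates `t_v = ρ v` are `1` for all vertices `v` outside `W`. -/
def coordinateSubtorus {V : Type} (Γ : SimpleGraph V) (W : Set V) : Set (CharacterTorus (RAAG Γ)) :=
  {ρ | ∀ v, v ∉ W → ρ (RAAG.gen Γ v) = 1}

/-- The full subgraph on `W` is disconnected, and `W` is maximal with respect to this property.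
A connected graph is non-empty here, so the empty graph is disconnected; this only matters when
the whole graph is complete, and then `W = ∅` is the only maximally disconnected subset. -/
def IsMaximallyDisconnected {V : Type} (Γ : SimpleGraph V) (W : Set V) : Prop :=
  Maximal (fun U : Set V => ¬ (Γ.induce U).Connected) W

/-- The irreducible components of a subset of a topological space, for the induced topology. -/
def componentsOf {X : Type} [TopologicalSpace X] (S : Set X) : Set (Set X) :=
  (fun Z : Set S => Subtype.val '' Z) '' irreducibleComponents S

end

/-! A twisted 1-cocycle is given by values `f v` on the generators with `(ρ v - 1) * f w = (ρ w - 1)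
* f v` on each edge; coboundaries are `f v = (ρ v - 1) * c`. Let `A` be the set of `v` with `ρ v ≠
1`. Along edges inside `A` the quotient `f v / (ρ v - 1)` is constant, and `f` vanishes at a vertex
outside `A` adjacent to `A`. So all cocycles are coboundaries if every superset of `A` induces a
connected graph, while a disconnected `W ⊇ A` yields a nontrivial cocycle from a separation of `W`.
Hence the variety is the union of the subtori of disconnected `W`, and by finiteness maximal `W`
suffice.

These subtori are closed, irreducible (`coordinateSubtorus.isIrreducible`) and ordered like the sets
`W` (`coordinateSubtorus.subset_iff`), so `componentsOf_iUnion` identifies the components. -/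

theorem RAAG.gen_mul_comm {V : Type} {Γ : SimpleGraph V} {v w : V} (h : Γ.Adj v w) :
    RAAG.gen Γ v * RAAG.gen Γ w = RAAG.gen Γ w * RAAG.gen Γ v := by
  rw [← mul_inv_eq_one]
  exact (PresentedGroup.one_of_mem (rels := {r : FreeGroup V | ∃ v w, Γ.Adj v w ∧
    r = FreeGroup.of v * FreeGroup.of w * (FreeGroup.of w * FreeGroup.of v)⁻¹}) ⟨v, w, h, rfl⟩)

theorem RAAG.exists_hom {V : Type} {Γ : SimpleGraph V} {H : Type} [Group H] (f : V → H)
    (hf : ∀ v w, Γ.Adj v w → f v * f w = f w * f v) :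
    ∃ φ : RAAG Γ →* H, ∀ v, φ (RAAG.gen Γ v) = f v := by
  refine ⟨PresentedGroup.toGroup (f := f) ?_, fun v => PresentedGroup.toGroup.of _⟩
  rintro _ ⟨v, w, h, rfl⟩
  simp only [map_mul, map_inv, FreeGroup.lift_apply_of]
  rw [hf v w h, mul_inv_cancel]

theorem RAAG.eq_top_of_gen_mem {V : Type} {Γ : SimpleGraph V} (K : Subgroup (RAAG Γ))
    (hK : ∀ v, RAAG.gen Γ v ∈ K) (g : RAAG Γ) : g ∈ K :=
  PresentedGroup.generated_by _ K hK g

/-! ### Zariski geometry of coordinate subtori -/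

/-- Logarithms may be chosen freely on generators since `ℂ` is commutative; the principal branch has
`log 1 = 0`. -/
theorem RAAG.exists_log {V : Type} {Γ : SimpleGraph V} (r : CharacterTorus (RAAG Γ)) :
    ∃ l : RAAG Γ →* Multiplicative ℂ,
      (∀ g, (r g : ℂ) = Complex.exp (l g).toAdd) ∧
      ∀ v, r (RAAG.gen Γ v) = 1 → l (RAAG.gen Γ v) = 1 := by
  obtain ⟨l, hl⟩ := RAAG.exists_hom (Γ := Γ)
    (fun v => Multiplicative.ofAdd (Complex.log (r (RAAG.gen Γ v)))) (fun _ _ _ => mul_comm _ _)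
  refine ⟨l, fun g => ?_, fun v hv => by rw [hl, hv]; simp⟩
  let K : Subgroup (RAAG Γ) :=
    { carrier := {g | (r g : ℂ) = Complex.exp (l g).toAdd}
      one_mem' := by simp
      mul_mem' := fun {a b} ha hb => by
        simp only [Set.mem_ofPred_eq] at ha hb ⊢
        simp [ha, hb, Complex.exp_add]
      inv_mem' := fun {a} ha => by
        simp only [Set.mem_ofPred_eq] at ha ⊢
        simp [ha, Complex.exp_neg] }
  refine RAAG.eq_top_of_gen_mem K (fun v => ?_) g
  change (r (RAAG.gen Γ v) : ℂ) = Complex.exp (l (RAAG.gen Γ v)).toAdd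
  rw [hl, toAdd_ofAdd, Complex.exp_log (Units.ne_zero _)]

/-- The complex one-parameter family of characters `g ↦ p g * exp (z * l g)`. -/
noncomputable def CharacterTorus.path {G : Type} [Group G] (p : CharacterTorus G) (l : G →* Multiplicative ℂ)
    (z : ℂ) : CharacterTorus G where
  toFun g := p g * Units.mk0 (Complex.exp (z * (l g).toAdd)) (Complex.exp_ne_zero _)
  map_one' := by ext; simp
  map_mul' a b := by ext; simp [mul_add, Complex.exp_add]; ring

theorem CharacterTorus.path_apply {G : Type} [Group G] (p : CharacterTorus G)
    (l : G →* Multiplicative ℂ) (z : ℂ) (g : G) :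
    (CharacterTorus.path p l z g : ℂ) = p g * Complex.exp (z * (l g).toAdd) := rfl

theorem CharacterTorus.eval_single {G : Type} [Group G] (p : CharacterTorus G) (g : G) (c : ℂ) :
    p.eval (MonoidAlgebra.single (Abelianization.of g) c) = c * p g := by
  simp [CharacterTorus.eval]

theorem CharacterTorus.differentiable_eval_path {G : Type} [Group G] (p : CharacterTorus G)
    (l : G →* Multiplicative ℂ) (f : MonoidAlgebra ℂ (Abelianization G)) :
    Differentiable ℂ fun z => (CharacterTorus.path p l z).eval f := by
  induction f using MonoidAlgebra.induction_linear with
  | zero => simp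
  | add f g hf hg =>
    simp only [map_add]
    exact hf.fun_add hg
  | single a c =>
    obtain ⟨g, rfl⟩ := QuotientGroup.mk_surjective a
    change Differentiable ℂ fun z => (CharacterTorus.path p l z).eval
      (MonoidAlgebra.single (Abelianization.of g) c)
    simp only [CharacterTorus.eval_single, CharacterTorus.path_apply]
    fun_prop

theorem CharacterTorus.isClosed_iff {G : Type} [Group G] {S : Set (CharacterTorus G)} :
    IsClosed S ↔ ∃ I, S = CharacterTorus.zeros I := by
  rw [← isOpen_compl_iff]
  change Sᶜᶜ ∈ {S | ∃ I, S = CharacterTorus.zeros I} ↔ _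
  rw [compl_compl]
  rfl

theorem coordinateSubtorus.isClosed {V : Type} (Γ : SimpleGraph V) (W : Set V) :
    IsClosed (coordinateSubtorus Γ W) := by
  rw [CharacterTorus.isClosed_iff]
  refine ⟨{f | ∃ v, v ∉ W ∧
    f = MonoidAlgebra.single (Abelianization.of (RAAG.gen Γ v)) 1 - 1}, ?_⟩
  ext ρ
  constructor
  · rintro h _ ⟨v, hv, rfl⟩
    rw [map_sub, CharacterTorus.eval_single, h v hv]
    simp
  · intro h v hv
    have := h _ ⟨v, hv, rfl⟩
    rw [map_sub, CharacterTorus.eval_single, map_one, sub_eq_zero, one_mul] at this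
    exact Units.ext this

theorem coordinateSubtorus.one_mem {V : Type} (Γ : SimpleGraph V) (W : Set V) :
    (1 : CharacterTorus (RAAG Γ)) ∈ coordinateSubtorus Γ W := fun _ _ => rfl

/-- Two points of the subtorus lie on an entire curve inside it; regular functions restrict to
entire functions of `z`, which have no zero divisors. -/
theorem coordinateSubtorus.isIrreducible {V : Type} (Γ : SimpleGraph V) (W : Set V) :
    IsIrreducible (coordinateSubtorus Γ W) := by
  refine ⟨⟨1, coordinateSubtorus.one_mem Γ W⟩, ?_⟩
  rw [isPreirreducible_iff_isClosed_union_isClosed]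
  intro A B hA hB hAB
  obtain ⟨I, rfl⟩ := CharacterTorus.isClosed_iff.1 hA
  obtain ⟨J, rfl⟩ := CharacterTorus.isClosed_iff.1 hB
  by_contra! hn
  obtain ⟨⟨p, hp, hpI⟩, ⟨q, hq, hqJ⟩⟩ := hn.imp Set.not_subset.1 Set.not_subset.1
  simp only [CharacterTorus.zeros, Set.mem_ofPred_eq, not_forall] at hpI hqJ
  obtain ⟨a, ha, hap⟩ := hpI
  obtain ⟨b, hb, hbq⟩ := hqJ
  -- With this `l` the curve runs from `p` at `z = 0` to `q` at `z = 1`.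
  obtain ⟨l, hl, hl1⟩ := RAAG.exists_log (q * p⁻¹)
  have h0 : CharacterTorus.path p l 0 = p := by
    ext g
    simp [CharacterTorus.path_apply]
  have h1 : CharacterTorus.path p l 1 = q := by
    ext g
    rw [CharacterTorus.path_apply, one_mul, ← hl, ← Units.val_mul, MonoidHom.mul_apply,
      MonoidHom.inv_apply, mul_comm (q _), mul_inv_cancel_left]
  have hmem (z : ℂ) : CharacterTorus.path p l z ∈ coordinateSubtorus Γ W := by
    intro v hv
    ext
    rw [CharacterTorus.path_apply, hl1 v (by simp [hp v hv, hq v hv]), hp v hv]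
    simp
  have hA := (CharacterTorus.differentiable_eval_path p l a).differentiableOn.analyticOnNhd
    isOpen_univ
  have hB := (CharacterTorus.differentiable_eval_path p l b).differentiableOn.analyticOnNhd
    isOpen_univ
  rcases AnalyticOnNhd.eq_zero_or_eq_zero_of_mul_eq_zero hA hB (fun z _ => by
    rcases hAB (hmem z) with h | h
    · simp [h a ha]
    · simp [h b hb]) isPreconnected_univ with h | h
  · exact hap (by simpa [h0] using h 0 trivial)
  · exact hbq (by simpa [h1] using h 1 trivial)

theorem coordinateSubtorus.subset_iff {V : Type} {Γ : SimpleGraph V} {W U : Set V} :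
    coordinateSubtorus Γ W ⊆ coordinateSubtorus Γ U ↔ W ⊆ U := by
  classical
  refine ⟨fun h v hv => ?_, fun h ρ hρ v hv => hρ v fun hw => hv (h hw)⟩
  by_contra hU
  -- A character that is nontrivial exactly at the vertices of `W`; any value other than 1 would do.
  obtain ⟨ρ, hρ⟩ := RAAG.exists_hom (Γ := Γ)
    (fun v => if v ∈ W then Units.mk0 (2 : ℂ) two_ne_zero else 1) (fun _ _ _ => mul_comm _ _)
  have h2 := h (show ρ ∈ coordinateSubtorus Γ W from fun w hw => by simp [hρ, hw]) v hU
  rw [hρ, if_pos hv] at h2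
  simpa using congrArg Units.val h2

/-- If a set is the union of a finite family of closed irreducible subsets that are pairwise
incomparable, then these subsets are its irreducible components. -/
theorem componentsOf_iUnion {X ι : Type} [TopologicalSpace X] {s : Set ι} (hs : s.Finite)
    {T : ι → Set X} (hc : ∀ i ∈ s, IsClosed (T i)) (hi : ∀ i ∈ s, IsIrreducible (T i))
    (ha : ∀ i ∈ s, ∀ j ∈ s, T i ⊆ T j → T j ⊆ T i) :
    componentsOf (⋃ i ∈ s, T i) = T '' s := by
  set S := ⋃ i ∈ s, T i with hS
  have hTS (i) (h : i ∈ s) : T i ⊆ S := Set.subset_biUnion_of_mem h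
  have hpre (i) (h : i ∈ s) : Subtype.val '' (Subtype.val ⁻¹' T i : Set S) = T i := by
    rw [Subtype.image_preimage_coe, Set.inter_eq_right.2 (hTS i h)]
  have hirr (Z : Set S) : IsIrreducible (Subtype.val '' Z) ↔ IsIrreducible Z := by
    refine ⟨fun h => ⟨h.1.of_image, ?_⟩, fun h => h.image _ continuous_subtype_val.continuousOn⟩
    rintro _ _ ⟨u, hu, rfl⟩ ⟨v, hv, rfl⟩ ⟨x, hxZ, hxu⟩ ⟨y, hyZ, hyv⟩
    obtain ⟨_, ⟨z, hz, rfl⟩, hzuv⟩ := h.2 u v hu hv ⟨x, ⟨x, hxZ, rfl⟩, hxu⟩ ⟨y, ⟨y, hyZ, rfl⟩, hyv⟩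
    exact ⟨z, hz, hzuv⟩
  have hle (Z : Set X) (hZ : IsIrreducible Z) (hZS : Z ⊆ S) : ∃ i ∈ s, Z ⊆ T i := by
    have := isIrreducible_iff_sUnion_isClosed.1 hZ (hs.image T).toFinset
      (by simpa using hc) (by simpa [hS] using hZS)
    simpa using this
  ext Z
  constructor
  · rintro ⟨Y, hY, rfl⟩
    obtain ⟨i, his, hYi⟩ := hle _ ((hirr Y).2 hY.1) (by simp)
    refine ⟨i, his, (hYi.antisymm ?_).symm⟩
    have := hY.2 (y := Subtype.val ⁻¹' T i) ((hirr _).1 (by rw [hpre i his]; exact hi i his))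
      (Set.image_subset_iff.1 hYi)
    rw [← hpre i his]
    exact Set.image_mono this
  · rintro ⟨i, his, rfl⟩
    refine ⟨Subtype.val ⁻¹' T i, ⟨(hirr _).1 (by rw [hpre i his]; exact hi i his), ?_⟩, hpre i his⟩
    intro Y hY hle'
    obtain ⟨j, hjs, hYj⟩ := hle _ ((hirr Y).2 hY) (by simp)
    refine Set.image_subset_iff.1 (hYj.trans (ha i his j hjs ?_))
    rw [← hpre i his]
    exact (Set.image_mono hle').trans hYj

/-! ### Twisted cocycles on generators -/

theorem mem_characteristicVariety_one_iff {G : Type} [Group G] {ρ : CharacterTorus G} :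
    ρ ∈ characteristicVariety G 1 ↔ ∃ f : G → ℂ,
      (∀ g h, f (g * h) = ρ g * f h + f g) ∧ ¬ ∃ c, ∀ g, f g = (ρ g - 1) * c := by
  have hd (f : G → ℂ) : (f : G → ρ.rep) ∈ groupCohomology.coboundaries₁ ρ.rep ↔
      ∃ c : ℂ, ∀ g, f g = (ρ g - 1) * c := by
    refine exists_congr fun (c : ℂ) => funext_iff.trans (forall_congr' fun g => ?_)
    rw [sub_one_mul]
    exact eq_comm
  have hz (f : G → ℂ) : (f : G → ρ.rep) ∈ groupCohomology.cocycles₁ ρ.rep ↔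
      ∀ g h, f (g * h) = ρ g * f h + f g :=
    groupCohomology.mem_cocycles₁_iff (A := ρ.rep) f
  change ((1 : ℕ) : Cardinal) ≤ Module.rank ℂ (groupCohomology.H1 ρ.rep) ↔ _
  rw [Nat.cast_one, Cardinal.one_le_iff_ne_zero, ne_eq, rank_zero_iff_forall_zero]
  constructor
  · intro h
    contrapose! h
    intro x
    induction x using groupCohomology.H1_induction_on with
    | h x => exact (groupCohomology.H1π_eq_zero_iff x).2 ((hd x).2 (h x ((hz x).1 x.2)))
  · rintro ⟨f, hf, hn⟩ h
    exact hn ((hd f).1 ((groupCohomology.H1π_eq_zero_iff ⟨f, (hz f).2 hf⟩).1 (h _)))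

/-- A cocycle is the translation part of a lift of `ρ` to the affine group `ℂ ⋊ ℂˣ`; the edge
condition says that the images of adjacent generators commute. -/
theorem RAAG.exists_cocycle {V : Type} {Γ : SimpleGraph V} (ρ : CharacterTorus (RAAG Γ))
    (f : V → ℂ) (hf : ∀ v w, Γ.Adj v w →
      (ρ (RAAG.gen Γ v) - 1 : ℂ) * f w = (ρ (RAAG.gen Γ w) - 1) * f v) :
    ∃ F : RAAG Γ → ℂ, (∀ g h, F (g * h) = ρ g * F h + F g) ∧ ∀ v, F (RAAG.gen Γ v) = f v := by
  let a : ℂˣ →* MulAut (Multiplicative ℂ) :=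
    { toFun u := AddEquiv.toMultiplicative (DistribMulAction.toAddAut ℂˣ ℂ u)
      map_one' := by ext; simp
      map_mul' x y := by ext; simp [mul_smul] }
  have ha (u : ℂˣ) (x : Multiplicative ℂ) : (a u x).toAdd = u * x.toAdd := rfl
  obtain ⟨φ, hφ⟩ := RAAG.exists_hom (Γ := Γ) (H := Multiplicative ℂ ⋊[a] ℂˣ)
    (fun v => ⟨Multiplicative.ofAdd (f v), ρ (RAAG.gen Γ v)⟩) (fun v w h => by
      refine SemidirectProduct.ext (Multiplicative.toAdd.injective ?_) (mul_comm _ _)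
      rw [SemidirectProduct.mul_left, SemidirectProduct.mul_left, toAdd_mul, toAdd_mul, ha, ha,
        toAdd_ofAdd, toAdd_ofAdd]
      linear_combination hf v w h)
  have hr : SemidirectProduct.rightHom.comp φ = ρ := by
    apply PresentedGroup.ext
    intro v
    exact congrArg SemidirectProduct.right (hφ v)
  refine ⟨fun g => (φ g).left.toAdd, fun g h => ?_, fun v => by simp [hφ]⟩
  beta_reduce
  rw [map_mul, SemidirectProduct.mul_left, toAdd_mul, ha, add_comm, ← hr]
  rfl

theorem RAAG.mem_characteristicVariety_one_iff {V : Type} {Γ : SimpleGraph V}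
    {ρ : CharacterTorus (RAAG Γ)} :
    ρ ∈ characteristicVariety (RAAG Γ) 1 ↔ ∃ f : V → ℂ,
      (∀ v w, Γ.Adj v w → (ρ (RAAG.gen Γ v) - 1 : ℂ) * f w = (ρ (RAAG.gen Γ w) - 1) * f v) ∧
      ¬ ∃ c : ℂ, ∀ v, f v = (ρ (RAAG.gen Γ v) - 1) * c := by
  rw [_root_.mem_characteristicVariety_one_iff]
  constructor
  · rintro ⟨F, hF, hn⟩
    refine ⟨fun v => F (RAAG.gen Γ v), fun v w h => ?_, ?_⟩
    · have h1 := hF (RAAG.gen Γ v) (RAAG.gen Γ w)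
      rw [RAAG.gen_mul_comm h, hF] at h1
      linear_combination -h1
    · rintro ⟨c, hc⟩
      have h1 : F 1 = 0 := by simpa using hF 1 1
      -- The locus where the cocycle `F` agrees with a given coboundary is a subgroup.
      let K : Subgroup (RAAG Γ) :=
        { carrier := {g | F g = (ρ g - 1) * c}
          one_mem' := by simp [h1]
          mul_mem' := fun {a b} ha hb => by
            simp only [Set.mem_ofPred_eq] at ha hb ⊢
            rw [hF, ha, hb, map_mul, Units.val_mul]
            ring
          inv_mem' := fun {a} ha => by
            simp only [Set.mem_ofPred_eq] at ha ⊢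
            have h2 := hF a a⁻¹
            rw [mul_inv_cancel, h1, ha] at h2
            have h3 : (ρ a : ℂ) * ρ a⁻¹ = 1 := by rw [← Units.val_mul, ← map_mul]; simp
            apply mul_left_cancel₀ (Units.ne_zero (ρ a))
            linear_combination -h2 - c * h3 }
      exact hn ⟨c, RAAG.eq_top_of_gen_mem K hc⟩
  · rintro ⟨f, hf, hn⟩
    obtain ⟨F, hF, hFf⟩ := RAAG.exists_cocycle ρ f hf
    exact ⟨F, hF, fun ⟨c, hc⟩ => hn ⟨c, fun v => by rw [← hFf, hc]⟩⟩

/-! ### Connectivity and cohomology -/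

/-- A non-empty disconnected full subgraph splits into two parts without edges between them. -/
theorem SimpleGraph.exists_separation_of_not_connected_induce {V : Type} {Γ : SimpleGraph V}
    {W : Set V} (hW : W.Nonempty) (h : ¬ (Γ.induce W).Connected) :
    ∃ S ⊆ W, S.Nonempty ∧ (W \ S).Nonempty ∧ ∀ v ∈ S, ∀ w ∈ W \ S, ¬ Γ.Adj v w := by
  have : Nonempty W := hW.to_subtype
  rw [SimpleGraph.connected_iff, and_iff_left this, SimpleGraph.Preconnected] at h
  push Not at h
  obtain ⟨x, y, hxy⟩ := h
  refine ⟨{v | ∃ hv : v ∈ W, (Γ.induce W).Reachable x ⟨v, hv⟩}, fun v hv => hv.1,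
    ⟨x, x.2, .refl _⟩, ⟨y, y.2, fun h => hxy h.2⟩, ?_⟩
  rintro v ⟨hv, hxv⟩ w ⟨hw, hxw⟩ hvw
  refine hxw ⟨hw, hxv.trans (SimpleGraph.Adj.reachable ?_)⟩
  exact hvw

/-- A vertex at which the character is trivial, as it is on all its neighbours, forces non-trivial
cohomology. -/
theorem RAAG.mem_characteristicVariety_of_vertex {V : Type} {Γ : SimpleGraph V}
    {ρ : CharacterTorus (RAAG Γ)} {s : V} (hs : ρ (RAAG.gen Γ s) = 1)
    (h : ∀ v, Γ.Adj v s → ρ (RAAG.gen Γ v) = 1) :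
    ρ ∈ characteristicVariety (RAAG Γ) 1 := by
  classical
  refine RAAG.mem_characteristicVariety_one_iff.2 ⟨Pi.single s 1, fun v w hvw => ?_, ?_⟩
  · by_cases hv : v = s <;> by_cases hw : w = s
    · rw [hv, hw]
    · subst hv
      simp [h w hvw.symm, hw]
    · subst hw
      simp [h v hvw, hv]
    · simp [hv, hw]
  · rintro ⟨c, hc⟩
    simpa [hs] using hc s

theorem RAAG.mem_characteristicVariety_of_not_connected {V : Type} [Nonempty V]
    {Γ : SimpleGraph V} {ρ : CharacterTorus (RAAG Γ)} {W : Set V}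
    (hW : ¬ (Γ.induce W).Connected) (hρ : ρ ∈ coordinateSubtorus Γ W) :
    ρ ∈ characteristicVariety (RAAG Γ) 1 := by
  classical
  rcases W.eq_empty_or_nonempty with rfl | hne
  · obtain ⟨s⟩ := ‹Nonempty V›
    exact RAAG.mem_characteristicVariety_of_vertex (hρ s (by simp)) fun v _ => hρ v (by simp)
  obtain ⟨S, hSW, ⟨s, hs⟩, ⟨t, ht⟩, hST⟩ :=
    SimpleGraph.exists_separation_of_not_connected_induce hne hW
  -- If `ρ` is trivial on one side of the separation, it is trivial on all neighbours of any vertex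
  -- of that side.
  by_cases hS : ∀ v ∈ S, ρ (RAAG.gen Γ v) = 1
  · refine RAAG.mem_characteristicVariety_of_vertex (hS s hs) fun v hv => ?_
    by_contra hn
    have hvW : v ∈ W := by_contra fun h => hn (hρ v h)
    exact hST s hs v ⟨hvW, fun h => hn (hS v h)⟩ hv.symm
  by_cases hT : ∀ v ∈ W \ S, ρ (RAAG.gen Γ v) = 1
  · refine RAAG.mem_characteristicVariety_of_vertex (hT t ht) fun v hv => ?_
    by_contra hn
    have hvW : v ∈ W := by_contra fun h => hn (hρ v h)
    exact hST v (by_contra fun h => hn (hT v ⟨hvW, h⟩)) t ht hv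
  push Not at hS hT
  obtain ⟨x, hx, hx1⟩ := hS
  obtain ⟨y, hy, hy1⟩ := hT
  have hne1 {v : V} (h : ρ (RAAG.gen Γ v) ≠ 1) : (ρ (RAAG.gen Γ v) - 1 : ℂ) ≠ 0 :=
    sub_ne_zero.2 fun h' => h (Units.ext h')
  have hout {v : V} (h : v ∉ W) : (ρ (RAAG.gen Γ v) - 1 : ℂ) = 0 := by simp [hρ v h]
  -- The cocycle is the coboundary with `c = 1` on `S` and with `c = 0` elsewhere; `x` and `y` rule
  -- out a common `c`.
  refine RAAG.mem_characteristicVariety_one_iff.2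
    ⟨fun v => if v ∈ S then (ρ (RAAG.gen Γ v) - 1 : ℂ) else 0, fun v w hvw => ?_, ?_⟩
  · by_cases hv : v ∈ S <;> by_cases hw : w ∈ S
    · simp [hv, hw, mul_comm]
    · have : w ∉ W := fun h => hST v hv w ⟨h, hw⟩ hvw
      simp [hw, hout this]
    · have : v ∉ W := fun h => hST w hw v ⟨h, hv⟩ hvw.symm
      simp [hv, hout this]
    · simp [hv, hw]
  · rintro ⟨c, hc⟩
    have h1 := hc x
    have h2 := hc y
    beta_reduce at h1 h2
    rw [if_pos hx, eq_comm, mul_eq_left₀ (hne1 hx1)] at h1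
    rw [if_neg hy.2, h1, mul_one] at h2
    exact hne1 hy1 h2.symm

theorem RAAG.exists_not_connected_of_mem_characteristicVariety {V : Type}
    {Γ : SimpleGraph V} {ρ : CharacterTorus (RAAG Γ)}
    (h : ρ ∈ characteristicVariety (RAAG Γ) 1) :
    ∃ W : Set V, ¬ (Γ.induce W).Connected ∧ ρ ∈ coordinateSubtorus Γ W := by
  obtain ⟨f, hf, hn⟩ := RAAG.mem_characteristicVariety_one_iff.1 h
  by_contra! hW
  set A : Set V := {v | ρ (RAAG.gen Γ v) ≠ 1} with hA
  have hne1 {v : V} (h : v ∈ A) : (ρ (RAAG.gen Γ v) - 1 : ℂ) ≠ 0 :=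
    sub_ne_zero.2 fun h' => h (Units.ext h')
  have hsup {W : Set V} (h : A ⊆ W) : (Γ.induce W).Connected := by
    by_contra hc
    exact hW W hc fun v hv => by_contra fun hv1 => hv (h hv1)
  have hAc := hsup subset_rfl
  -- `A` is nonempty because the empty graph is not `Connected`.
  obtain ⟨a⟩ := hAc.nonempty
  have hconst (v : A) : f v / (ρ (RAAG.gen Γ v) - 1) = f a / (ρ (RAAG.gen Γ a) - 1) := by
    obtain ⟨p⟩ := hAc.preconnected v a
    induction p with
    | nil => rfl
    | @cons u v w huv _ ih =>
      rw [← ih, div_eq_div_iff (hne1 u.2) (hne1 v.2)]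
      linear_combination -hf u v huv
  refine hn ⟨f a / (ρ (RAAG.gen Γ a) - 1), fun v => ?_⟩
  by_cases hv : v ∈ A
  · rw [← hconst ⟨v, hv⟩, mul_div_cancel₀ _ (hne1 hv)]
  have hv1 : (ρ (RAAG.gen Γ v) - 1 : ℂ) = 0 := by
    simp only [hA, Set.mem_ofPred_eq, not_not] at hv
    simp [hv]
  -- In the connected graph on `insert v A`, the first step of a walk from `v` lands in `A`, and
  -- that edge forces `f v = 0`.
  obtain ⟨p⟩ := (hsup (Set.subset_insert v A)).preconnected ⟨v, Set.mem_insert _ _⟩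
    ⟨a, Set.mem_insert_of_mem _ a.2⟩
  cases p with
  | nil => exact absurd a.2 hv
  | @cons _ w _ hvw _ =>
    have hadj : Γ.Adj v w := hvw
    have hwA : w.1 ∈ A := w.2.resolve_left hadj.ne'
    have := hf v w hadj
    rw [hv1, zero_mul, eq_comm, mul_eq_zero] at this
    rw [this.resolve_left (hne1 hwA), hv1, zero_mul]

theorem proposition9p2 {V : Type} [Finite V] [Nonempty V] (Γ : SimpleGraph V) :
    characteristicVariety (RAAG Γ) 1 =
        ⋃ W ∈ {W : Set V | IsMaximallyDisconnected Γ W}, coordinateSubtorus Γ W ∧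
      Set.BijOn (coordinateSubtorus Γ) {W : Set V | IsMaximallyDisconnected Γ W}
        (componentsOf (characteristicVariety (RAAG Γ) 1)) := by
  have hunion : characteristicVariety (RAAG Γ) 1 =
      ⋃ W ∈ {W : Set V | IsMaximallyDisconnected Γ W}, coordinateSubtorus Γ W := by
    ext ρ
    simp only [Set.mem_iUnion]
    constructor
    · intro h
      obtain ⟨U, hU, hρ⟩ := RAAG.exists_not_connected_of_mem_characteristicVariety h
      obtain ⟨W, hUW, hW⟩ :=
        (Set.toFinite {U : Set V | ¬ (Γ.induce U).Connected}).exists_le_maximal hU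
      exact ⟨W, hW, coordinateSubtorus.subset_iff.2 hUW hρ⟩
    · rintro ⟨W, hW, hρ⟩
      exact RAAG.mem_characteristicVariety_of_not_connected hW.1 hρ
  refine ⟨hunion, ?_⟩
  rw [hunion, componentsOf_iUnion (Set.toFinite _)
    (fun W _ => coordinateSubtorus.isClosed Γ W) (fun W _ => coordinateSubtorus.isIrreducible Γ W)
    (fun W hW U hU h => coordinateSubtorus.subset_iff.2
      (hW.2 hU.1 (coordinateSubtorus.subset_iff.1 h)))]
  refine Set.InjOn.bijOn_image fun W _ U _ h => ?_
  exact (coordinateSubtorus.subset_iff.1 h.le).antisymm (coordinateSubtorus.subset_iff.1 h.ge)
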